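/- Let $d\ge 1$ be an integer. For $n\ge 2$ let $\mathbb T_n^d=(\mathbb R/n^{1/d}\mathbb Z)^d$ be the flat torus of dimension $d$ and volume $n$, equipped with the metric inherited from the Euclidean metric of $\mathbb R^d$. The $d$-NN tree $G_n$ is the following random tree on the vertex set $\{0,1,\dots,n-1\}$: the vertices are given independent uniformly distributed positions $p_0,\dots,p_{n-1}$ in $\mathbb T_n^d$, and every vertex $i>0$ is joined by an edge to a vertex $j<i$ whose position is closest to $p_i$ among $p_0,\dots,p_{i-1}$ (ties, which almost surely do not occur, are broken arbitrarily). The Euclidean length of a path in $G_n$ is the sum, over its edges $\{i,j\}$, of the distances between $p_i$ and $p_j$ in $\mathbb T^d_n$. The stretch factor between two vertices $u\neq v$ with $p_u\ne p_v$ is the Euclidean length of the path in $G_n$ between $u$ and $v$, divided by the distance between $p_u$ and $p_v$ in $\mathbb T_n^d$. For every $\varepsilon\in(0,d^{-d/2})$ there exists a constant $c=c(\varepsilon,d)>0$ such that, for every $n\ge 2$, if $(u,v)$ is a pair of distinct vertices of $G_n$ chosen uniformly at random, independently of the positions, then with probability at least $1-\varepsilon$ one has $p_u\neq p_v$ and the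 stretch factor between $u$ and $v$ is at most $c$. -/

import Mathlib

open MeasureTheory ProbabilityTheory

/-- The side length `n^{1/d}` of the `d`-dimensional torus of volume `n`. -/
noncomputable def torusSide (d n : ℕ) : ℝ := (n : ℝ) ^ (1 / (d : ℝ))

instance torusSide_fact (d n : ℕ) [NeZero n] : Fact (0 < torusSide d n) :=
  ⟨Real.rpow_pos_of_pos (Nat.cast_pos.2 (Nat.pos_of_neZero n)) _⟩

/-- The flat torus `(ℝ / n^{1/d} ℤ)^d` of dimension `d` and volume `n`. Its `dist` is the metric
inherited from the Euclidean metric of `ℝ^d`: the `ℓ²`-combination of the circle distances of the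
coordinates. -/
abbrev FlatTorus (d n : ℕ) : Type := PiLp 2 (fun _ : Fin d => AddCircle (torusSide d n))

/-- The uniform probability measure on the flat torus: the product of the Haar probability
measures of the circles. -/
noncomputable def torusUniform (d n : ℕ) [NeZero n] : Measure (FlatTorus d n) :=
  (Measure.pi fun _ : Fin d => (AddCircle.haarAddCircle : Measure (AddCircle (torusSide d n)))).map
    (WithLp.toLp 2)

/-- `G` is an online nearest neighbor tree of the points `p 0, …, p (n-1)` (in order of arrival):
its edges join every vertex `i > 0` to a vertex `a i` which is closest to `i` among the vertices
with a smaller label; ties are broken arbitrarily. -/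
def IsNNTree {X : Type*} [PseudoMetricSpace X] {n : ℕ} (p : Fin n → X)
    (G : SimpleGraph (Fin n)) : Prop :=
  ∃ a : Fin n → Fin n,
    (∀ i : Fin n, 0 < i.val → a i < i ∧ ∀ j < i, dist (p i) (p (a i)) ≤ dist (p i) (p j)) ∧
    ∀ i j : Fin n, G.Adj i j ↔ (0 < i.val ∧ a i = j) ∨ (0 < j.val ∧ a j = i)

theorem IsNNTree.isTree {X : Type*} [PseudoMetricSpace X] {n : ℕ} {p : Fin n → X}
    {G : SimpleGraph (Fin n)} (h : IsNNTree p G) (hn : 0 < n) : G.IsTree := by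
  classical
  obtain ⟨a, ha, hG⟩ := h
  have hr : ∀ k : ℕ, ∀ hk : k < n, G.Reachable ⟨k, hk⟩ ⟨0, hn⟩ := by
    intro k
    induction k using Nat.strong_induction_on with
    | _ k ih =>
      intro hk
      rcases Nat.eq_zero_or_pos k with rfl | hpos
      · exact SimpleGraph.Reachable.refl _
      · have h1 := (ha ⟨k, hk⟩ hpos).1
        have h2 : G.Adj ⟨k, hk⟩ (a ⟨k, hk⟩) := (hG _ _).2 (Or.inl ⟨hpos, rfl⟩)
        exact h2.reachable.trans (ih (a ⟨k, hk⟩).val h1 (a ⟨k, hk⟩).isLt)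
  have hc : G.Connected :=
    { preconnected := fun u v => (hr u.val u.isLt).trans (hr v.val v.isLt).symm
      nonempty := ⟨⟨0, hn⟩⟩ }
  refine SimpleGraph.isTree_iff_connected_and_card.2 ⟨hc, le_antisymm ?_ ?_⟩
  · have hsub : G.edgeSet ⊆
        ((Finset.univ.erase (⟨0, hn⟩ : Fin n)).image fun i => s(i, a i) : Finset (Sym2 (Fin n))) := by
      intro e he
      induction e using Sym2.ind with
      | _ x y =>
        have hxy : G.Adj x y := he
        simp only [Finset.coe_image, Set.mem_image, Finset.mem_coe, Finset.mem_erase,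
          Finset.mem_univ, and_true]
        rcases (hG x y).1 hxy with ⟨h0, rfl⟩ | ⟨h0, rfl⟩
        · exact ⟨x, fun hx => by simp [hx] at h0, rfl⟩
        · exact ⟨y, fun hx => by simp [hx] at h0, Sym2.eq_swap⟩
    have h1 : Nat.card G.edgeSet ≤ n - 1 := by
      calc Nat.card G.edgeSet ≤ _ := Nat.card_mono (Finset.finite_toSet _) hsub
        _ ≤ (Finset.univ.erase (⟨0, hn⟩ : Fin n)).card := by
          rw [Nat.card_coe_set_eq, Set.ncard_coe_finset]
          exact Finset.card_image_le
        _ = n - 1 := by simp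
    rw [Nat.card_eq_fintype_card (α := Fin n), Fintype.card_fin]
    omega
  · exact hc.card_vert_le_card_edgeSet_add_one

theorem IsNNTree.existsUnique_path {X : Type*} [PseudoMetricSpace X] {n : ℕ} {p : Fin n → X}
    {G : SimpleGraph (Fin n)} (h : IsNNTree p G) (u v : Fin n) :
    ∃! w : G.Walk u v, w.IsPath :=
  (h.isTree (Nat.zero_lt_of_lt u.isLt)).existsUnique_path u v

/-- The path between `u` and `v` in the nearest neighbor tree. -/
noncomputable def IsNNTree.treePath {X : Type*} [PseudoMetricSpace X] {n : ℕ} {p : Fin n → X}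
    {G : SimpleGraph (Fin n)} (h : IsNNTree p G) (u v : Fin n) : G.Walk u v :=
  (h.existsUnique_path u v).choose

/-- The Euclidean length of a walk: the sum of the distances between the endpoints of its edges. -/
noncomputable def euclideanLength {V X : Type*} [PseudoMetricSpace X] {G : SimpleGraph V}
    (p : V → X) {u v : V} (w : G.Walk u v) : ℝ :=
  (w.darts.map fun e => dist (p e.fst) (p e.snd)).sum

/-- The stretch factor between `u` and `v`: the Euclidean length of the tree path divided by the
distance of the positions (meaningful when the two positions are different). -/
noncomputable def IsNNTree.stretchFactor {X : Type*} [PseudoMetricSpace X] {n : ℕ} {p : Fin n → X}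
    {G : SimpleGraph (Fin n)} (h : IsNNTree p G) (u v : Fin n) : ℝ :=
  euclideanLength p (h.treePath u v) / dist (p u) (p v)

/-! The natural scale is the side length `torusSide d n`: a random pair is rarely much closer than
this, while its tree path has mean length of at most this order. The path from `u` to `v` is no
longer than the two descents to vertex 0 together, so it suffices to bound the mean ancestral length
of one vertex.

Two estimates do this. By exchangeability of the positions with labels at most `j`, the first such
label met by the descent from `i > j` is uniform on `0, …, j`; so `j` is an ancestor of `i` with
probability at most `1 / (j + 1)` (`measure_isAncestor_le`). Moreover, the `j` earlier points all
miss a ball of measure at least `q` around point `j` with probability at most `(1 - q) ^ j`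
(`measure_lt_parentDist_le`). With radius of order `j ^ (-1 / (2d))` times the side length one may
take `q = j ^ (-1 / 2)`. The contribution of `j` is then a summable multiple of the side length, and
Markov's inequality with a union bound finishes. -/

/-! ### Deterministic part: descents to the root, path length, relabelling. -/

section Genealogy

variable {X : Type*} [PseudoMetricSpace X] {n : ℕ}

/-- `j` is a nearest point of `i` among the points with a smaller label. -/
def IsParent (x : Fin n → X) (i j : Fin n) : Prop :=
  j < i ∧ ∀ k < i, dist (x i) (x j) ≤ dist (x i) (x k)

/-- `j` is reached from `i` by following nearest earlier points. -/
def IsAncestor (x : Fin n → X) : Fin n → Fin n → Prop := Relation.ReflTransGen (IsParent x)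

/-- The distance of the point `j` to the set of earlier points. -/
noncomputable def parentDist (x : Fin n → X) (j : Fin n) : ENNReal :=
  ⨅ k, ⨅ _ : k < j, edist (x j) (x k)

open Classical in
/-- The sum of the distances to the earlier points over all ancestors of `i`. -/
noncomputable def ancestralLength (x : Fin n → X) (i : Fin n) : ENNReal :=
  ∑ j : Fin n with 0 < j.val, if IsAncestor x i j then parentDist x j else 0

theorem IsAncestor.le {x : Fin n → X} {i j : Fin n} (h : IsAncestor x i j) : j ≤ i := by
  induction h with
  | refl => exact le_rfl
  | tail _ h ih => exact h.1.le.trans ih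

theorem isAncestor_iff {x : Fin n → X} {i j : Fin n} :
    IsAncestor x i j ↔ i = j ∨ ∃ k, IsParent x i k ∧ IsAncestor x k j :=
  Relation.ReflTransGen.cases_head_iff

theorem IsParent.edist_le_parentDist {x : Fin n → X} {i j : Fin n} (h : IsParent x i j) :
    edist (x i) (x j) ≤ parentDist x i := by
  refine le_iInf₂ fun k hk => ?_
  rw [edist_dist, edist_dist]
  exact ENNReal.ofReal_le_ofReal (h.2 k hk)

/-- Ancestors never have larger labels, so the term of `i` is absent from the sum for `j`; every
ancestor of `j` is one of `i`. -/
theorem edist_add_ancestralLength_le {x : Fin n → X} {i j : Fin n} (h : IsParent x i j) :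
    edist (x i) (x j) + ancestralLength x j ≤ ancestralLength x i := by
  classical
  have hi : 0 < i.val := Nat.zero_lt_of_lt h.1
  have hmem : i ∈ Finset.univ.filter fun j : Fin n => 0 < j.val := by simp [hi]
  unfold ancestralLength
  rw [← Finset.add_sum_erase _ _ hmem, ← Finset.add_sum_erase _ _ hmem,
    if_neg fun hji : IsAncestor x j i => absurd hji.le (not_le.2 h.1),
    if_pos (show IsAncestor x i i from Relation.ReflTransGen.refl), zero_add]
  refine add_le_add h.edist_le_parentDist (Finset.sum_le_sum fun k _ => ?_)
  by_cases hk : IsAncestor x j k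
  · rw [if_pos hk, if_pos (show IsAncestor x i k from Relation.ReflTransGen.head h hk)]
  · simp [hk]

theorem euclideanLength_append {V : Type*} {G : SimpleGraph V} (p : V → X) {u v w : V}
    (a : G.Walk u v) (b : G.Walk v w) :
    euclideanLength p (a.append b) = euclideanLength p a + euclideanLength p b := by
  simp [euclideanLength]

theorem euclideanLength_reverse {V : Type*} {G : SimpleGraph V} (p : V → X) {u v : V}
    (a : G.Walk u v) : euclideanLength p a.reverse = euclideanLength p a := by
  simp only [euclideanLength, SimpleGraph.Walk.darts_reverse, List.map_reverse, List.sum_reverse,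
    List.map_map]
  congr 2
  funext e
  exact dist_comm _ _

theorem euclideanLength_bypass_le {V : Type*} [DecidableEq V] {G : SimpleGraph V} (p : V → X)
    {u v : V} (a : G.Walk u v) : euclideanLength p a.bypass ≤ euclideanLength p a := by
  obtain ⟨l, hl, hs⟩ : a.bypass.darts.Subperm a.darts :=
    (List.Nodup.of_map _ (a.bypass_isPath.isTrail.edges_nodup)).subperm
      a.darts_bypass_subset_darts
  unfold euclideanLength
  rw [← (hl.map _).sum_eq]
  refine (hs.map fun e => dist (p e.fst) (p e.snd)).sum_le_sum fun r hr => ?_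
  obtain ⟨e, -, rfl⟩ := List.mem_map.1 hr
  exact dist_nonneg

theorem IsNNTree.exists_walk_root {p : Fin n → X} {G : SimpleGraph (Fin n)} (h : IsNNTree p G)
    (hn : 0 < n) (i : Fin n) :
    ∃ w : G.Walk i ⟨0, hn⟩, ENNReal.ofReal (euclideanLength p w) ≤ ancestralLength p i := by
  obtain ⟨a, ha, hG⟩ := h
  induction i using WellFoundedLT.induction with
  | ind i ih =>
    rcases Nat.eq_zero_or_pos i.val with h0 | hpos
    · obtain rfl : i = ⟨0, hn⟩ := Fin.ext h0
      exact ⟨.nil, by simp [euclideanLength]⟩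
    · obtain ⟨w, hw⟩ := ih (a i) (ha i hpos).1
      refine ⟨.cons ((hG _ _).2 (Or.inl ⟨hpos, rfl⟩)) w, ?_⟩
      refine le_trans ?_ (edist_add_ancestralLength_le (ha i hpos))
      simp only [euclideanLength, SimpleGraph.Walk.darts_cons, List.map_cons, List.sum_cons]
      refine ENNReal.ofReal_add_le.trans (add_le_add ?_ hw)
      rw [edist_dist]

/-- The tree path is the bypass of the walk through the root, and shortcutting only discards edges.
This holds for every tie-breaking, since `IsAncestor` follows all nearest earlier points. -/
theorem IsNNTree.euclideanLength_treePath_le {p : Fin n → X} {G : SimpleGraph (Fin n)}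
    (h : IsNNTree p G) (u v : Fin n) :
    ENNReal.ofReal (euclideanLength p (h.treePath u v)) ≤
      ancestralLength p u + ancestralLength p v := by
  classical
  have hn : 0 < n := Nat.zero_lt_of_lt u.isLt
  obtain ⟨a, ha⟩ := h.exists_walk_root hn u
  obtain ⟨b, hb⟩ := h.exists_walk_root hn v
  have hpath : h.treePath u v = (a.append b.reverse).bypass :=
    (h.existsUnique_path u v).unique (h.existsUnique_path u v).choose_spec.1
      (SimpleGraph.Walk.bypass_isPath _)
  rw [hpath]
  refine (ENNReal.ofReal_le_ofReal (euclideanLength_bypass_le p _)).trans ?_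
  rw [euclideanLength_append, euclideanLength_reverse]
  exact ENNReal.ofReal_add_le.trans (add_le_add ha hb)

/-- `k` is the first label at most `j` on a descending chain of nearest earlier points from `i`. -/
def IsEntrance (x : Fin n → X) (j i k : Fin n) : Prop :=
  k ≤ j ∧ ∃ m, j < m ∧ IsAncestor x i m ∧ IsParent x m k

theorem IsAncestor.isEntrance {x : Fin n → X} {i j : Fin n} (h : IsAncestor x i j) (hji : j < i) :
    IsEntrance x j i j := by
  rcases Relation.ReflTransGen.cases_tail h with rfl | ⟨m, him, hmj⟩
  · exact absurd hji (lt_irrefl _)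
  · exact ⟨le_rfl, m, hmj.1, him, hmj⟩

/-- A permutation fixing all labels above `j` preserves the set of labels below `m`, so `m` sees the
same earlier positions under other names. -/
theorem isParent_comp_perm {x : Fin n → X} {j m k : Fin n} {σ : Equiv.Perm (Fin n)}
    (hσ : ∀ l, j < l → σ l = l) (hm : j < m) :
    IsParent (x ∘ σ) m k ↔ IsParent x m (σ k) := by
  have hlt : ∀ l, σ l < m ↔ l < m := by
    intro l
    by_cases hl : j < l
    · rw [hσ l hl]
    · have h2 : ¬ j < σ l := fun h2 => hl (by rwa [← σ.injective (hσ _ h2)])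
      exact ⟨fun _ => (not_lt.1 hl).trans_lt hm, fun _ => (not_lt.1 h2).trans_lt hm⟩
  simp only [IsParent, Function.comp, hσ m hm, hlt]
  refine and_congr_right fun _ => ⟨fun h l hl => ?_, fun h l hl => h _ ((hlt l).2 hl)⟩
  have := h (σ.symm l) ((hlt _).1 (by simpa using hl))
  simpa using this

/-- A descent ending at `m > j` visits only labels above `j`, all of them fixed by `σ`. -/
theorem isAncestor_comp_perm {x : Fin n → X} {j i m : Fin n} {σ : Equiv.Perm (Fin n)}
    (hσ : ∀ l, j < l → σ l = l) (hm : j < m) :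
    IsAncestor (x ∘ σ) i m ↔ IsAncestor x i m := by
  have aux : ∀ (y z : Fin n → X), (∀ l k, j < l → j < k → IsParent y l k → IsParent z l k) →
      IsAncestor y i m → IsAncestor z i m := by
    intro y z hyz h
    induction h using Relation.ReflTransGen.head_induction_on with
    | refl => exact Relation.ReflTransGen.refl
    | head hab hbm ih =>
      have hb := hm.trans_le (IsAncestor.le hbm)
      exact Relation.ReflTransGen.head (hyz _ _ (hb.trans hab.1) hb hab) ih
  constructor
  · refine aux _ _ fun l k hl hk h => ?_
    have := (isParent_comp_perm hσ hl).1 h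
    rwa [hσ k hk] at this
  · refine aux _ _ fun l k hl hk h => ?_
    rw [isParent_comp_perm hσ hl, hσ k hk]
    exact h

theorem isEntrance_comp_swap {x : Fin n → X} {j i k : Fin n} (hk : k ≤ j) :
    IsEntrance (x ∘ Equiv.swap j k) j i j ↔ IsEntrance x j i k := by
  have hσ : ∀ l, j < l → Equiv.swap j k l = l := fun l hl =>
    Equiv.swap_apply_of_ne_of_ne hl.ne' (hk.trans_lt hl).ne'
  simp only [IsEntrance, le_refl, hk, true_and]
  refine exists_congr fun m => and_congr_right fun hm => ?_
  rw [isAncestor_comp_perm hσ hm, isParent_comp_perm hσ hm, Equiv.swap_apply_left]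

/-- No point is at the same distance from two other points. -/
def HasNoTies (x : Fin n → X) : Prop :=
  ∀ m k l : Fin n, k ≠ m → l ≠ m → k ≠ l → dist (x m) (x k) ≠ dist (x m) (x l)

theorem HasNoTies.rightUnique {x : Fin n → X} (h : HasNoTies x) :
    Relator.RightUnique (IsParent x) := by
  intro m k l hk hl
  by_contra hkl
  exact h m k l hk.1.ne hl.1.ne hkl (le_antisymm (hk.2 _ hl.1) (hl.2 _ hk.1))

/-- Without ties the descent from `i` is a single chain, and it drops to labels at most `j` only
once. -/
theorem HasNoTies.isEntrance_unique {x : Fin n → X} (h : HasNoTies x) {j i k l : Fin n}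
    (hk : IsEntrance x j i k) (hl : IsEntrance x j i l) : k = l := by
  have aux : ∀ {k l m m' : Fin n}, k ≤ j → IsParent x m k → j < m' → IsParent x m' l →
      IsAncestor x m m' → k = l := by
    intro k l m m' hkj hmk hm' hml hmm
    rcases isAncestor_iff.1 hmm with rfl | ⟨k', hmk', hk'⟩
    · exact h.rightUnique hmk hml
    · obtain rfl := h.rightUnique hmk hmk'
      exact absurd (hk'.le.trans hkj) (not_le.2 hm')
  obtain ⟨hkj, m, hm, him, hmk⟩ := hk
  obtain ⟨hlj, m', hm', him', hml⟩ := hl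
  rcases Relation.ReflTransGen.total_of_right_unique h.rightUnique him him' with hmm | hmm
  · exact aux hkj hmk hm' hml hmm
  · exact (aux hlj hml hm hmk hmm).symm

end Genealogy

/-! ### Measurability and the exchangeability bound for ancestors. -/

section Exchangeability

variable {X : Type*} [PseudoMetricSpace X] [SecondCountableTopology X] [MeasurableSpace X]
  [OpensMeasurableSpace X] {n : ℕ}

theorem measurable_dist_coord (i j : Fin n) :
    Measurable fun x : Fin n → X => dist (x i) (x j) :=
  (measurable_pi_apply i).dist (measurable_pi_apply j)

theorem measurableSet_isParent (i j : Fin n) :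
    MeasurableSet {x : Fin n → X | IsParent x i j} := by
  simp only [IsParent, Set.ofPred_and, Set.ofPred_forall]
  refine (MeasurableSet.const _).inter (MeasurableSet.iInter fun k => MeasurableSet.iInter fun _ => ?_)
  exact measurableSet_le (measurable_dist_coord i j) (measurable_dist_coord i k)

theorem measurableSet_isAncestor (i j : Fin n) :
    MeasurableSet {x : Fin n → X | IsAncestor x i j} := by
  induction i using WellFoundedLT.induction with
  | ind i ih =>
    have : {x : Fin n → X | IsAncestor x i j} =
        {_x | i = j} ∪ ⋃ k, {x | IsParent x i k ∧ IsAncestor x k j} := by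
      ext x
      simp only [Set.mem_ofPred_eq, Set.mem_union, Set.mem_iUnion]
      exact isAncestor_iff
    rw [this]
    refine (MeasurableSet.const _).union (MeasurableSet.iUnion fun k => ?_)
    by_cases hk : k < i
    · exact (measurableSet_isParent i k).inter (ih k hk)
    · have : {x : Fin n → X | IsParent x i k ∧ IsAncestor x k j} = ∅ :=
        Set.eq_empty_of_forall_notMem fun x hx => hk hx.1.1
      rw [this]
      exact MeasurableSet.empty

theorem measurableSet_isEntrance (j i k : Fin n) :
    MeasurableSet {x : Fin n → X | IsEntrance x j i k} := by
  simp only [IsEntrance, Set.ofPred_and, Set.ofPred_exists]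
  exact (MeasurableSet.const _).inter (MeasurableSet.iUnion fun m => (MeasurableSet.const _).inter
    ((measurableSet_isAncestor i m).inter (measurableSet_isParent m k)))

theorem measurable_parentDist (j : Fin n) :
    Measurable fun x : Fin n → X => parentDist x j :=
  Measurable.iInf fun k => Measurable.iInf fun _ =>
    (measurable_pi_apply j).edist (measurable_pi_apply k)

theorem measurable_ancestralLength (i : Fin n) :
    Measurable fun x : Fin n → X => ancestralLength x i := by
  unfold ancestralLength
  exact Finset.measurable_sum _ fun j _ =>
    Measurable.ite (measurableSet_isAncestor i j) (measurable_parentDist j) measurable_const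

variable (μ : Measure X) [IsProbabilityMeasure μ]

theorem measurePreserving_comp_perm {ι X : Type*} [Fintype ι] [MeasurableSpace X] (μ : Measure X)
    [SigmaFinite μ] (σ : Equiv.Perm ι) :
    MeasurePreserving (fun x : ι → X => x ∘ σ) (Measure.pi fun _ => μ)
      (Measure.pi fun _ => μ) := by
  have := measurePreserving_arrowCongr' (fun _ => μ) (fun _ => μ) σ.symm (MeasurableEquiv.refl X)
    fun _ => MeasurePreserving.id μ
  exact this

theorem measure_isEntrance_eq (j i k : Fin n) (hk : k ≤ j) :
    (Measure.pi fun _ : Fin n => μ) {x | IsEntrance x j i k} =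
      (Measure.pi fun _ : Fin n => μ) {x | IsEntrance x j i j} := by
  rw [← (measurePreserving_comp_perm μ (Equiv.swap j k)).measure_preimage
    (measurableSet_isEntrance j i j).nullMeasurableSet]
  simp only [Set.preimage_ofPred_eq, isEntrance_comp_swap hk]

/-- The events that `k` is the entrance, for the `j + 1` labels `k ≤ j`, are almost surely disjoint
and equally likely, so each has probability at most `1 / (j + 1)`. An ancestor `j < i` is itself the
entrance at level `j`. -/
theorem measure_isAncestor_le
    (hμ : ∀ᵐ x ∂(Measure.pi fun _ : Fin n => μ), HasNoTies x) {i j : Fin n} (hji : j < i) :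
    (Measure.pi fun _ : Fin n => μ) {x | IsAncestor x i j} ≤ ((j.val : ENNReal) + 1)⁻¹ := by
  set ν := Measure.pi fun _ : Fin n => μ
  refine (measure_mono fun x (hx : IsAncestor x i j) => hx.isEntrance hji).trans ?_
  have hsum : ∑ k ∈ Finset.Iic j, ν {x | IsEntrance x j i k} ≤ 1 := by
    rw [← measure_biUnion_finset₀]
    · exact prob_le_one
    · intro k _ l _ hkl
      have hae : ∀ᵐ x ∂ν, x ∉ {x | IsEntrance x j i k} ∩ {x | IsEntrance x j i l} := by
        filter_upwards [hμ] with x hx hx'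
        exact hkl (hx.isEntrance_unique hx'.1 hx'.2)
      exact measure_eq_zero_iff_ae_notMem.2 hae
    · exact fun k _ => (measurableSet_isEntrance j i k).nullMeasurableSet
  rw [Finset.sum_congr rfl fun k hk => measure_isEntrance_eq μ j i k (Finset.mem_Iic.1 hk),
    Finset.sum_const, Fin.card_Iic, nsmul_eq_mul] at hsum
  rw [← one_div, ENNReal.le_div_iff_mul_le (by simp) (by simp), mul_comm]
  exact_mod_cast hsum

end Exchangeability

/-! ### Integrating out one position: ties, nearest-point tails, mean length. -/

section Product

theorem measurable_insertNth {X : Type*} [MeasurableSpace X] {n : ℕ} (l : Fin (n + 1)) :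
    Measurable fun q : X × (Fin n → X) => (l.insertNth q.1 q.2 : Fin (n + 1) → X) :=
  (MeasurableEquiv.piFinSuccAbove (fun _ : Fin (n + 1) => X) l).symm.measurable

theorem measurePreserving_insertNth {X : Type*} [MeasurableSpace X] {n : ℕ} (μ : Measure X)
    [SigmaFinite μ] (l : Fin (n + 1)) :
    MeasurePreserving (fun q : X × (Fin n → X) => (l.insertNth q.1 q.2 : Fin (n + 1) → X))
      (μ.prod (Measure.pi fun _ => μ)) (Measure.pi fun _ => μ) :=
  (measurePreserving_piFinSuccAbove (fun _ : Fin (n + 1) => μ) l).symm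

/-- A set of configurations is null if all its sections in the direction of one coordinate are. -/
theorem measure_pi_eq_zero_of_section {X : Type*} [MeasurableSpace X] {n : ℕ} (μ : Measure X)
    [SigmaFinite μ] (l : Fin (n + 1)) {s : Set (Fin (n + 1) → X)} (hs : MeasurableSet s)
    (h : ∀ w : Fin n → X, μ {z | (l.insertNth z w : Fin (n + 1) → X) ∈ s} = 0) :
    (Measure.pi fun _ => μ) s = 0 := by
  rw [← (measurePreserving_insertNth μ l).measure_preimage hs.nullMeasurableSet,
    Measure.prod_apply_symm (measurable_insertNth l hs)]
  refine lintegral_eq_zero_of_ae_eq_zero (Filter.Eventually.of_forall fun w => ?_)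
  exact h w

variable {X : Type*} [PseudoMetricSpace X] [SecondCountableTopology X] [MeasurableSpace X]
  [OpensMeasurableSpace X] (μ : Measure X) [IsProbabilityMeasure μ]

/-- With all positions but that of `l` fixed, a tie forces the point `l` onto a sphere. -/
theorem ae_hasNoTies (hμ : ∀ y r, μ (Metric.sphere y r) = 0) (n : ℕ) :
    ∀ᵐ x ∂(Measure.pi fun _ : Fin n => μ), HasNoTies x := by
  simp only [HasNoTies, ae_all_iff]
  intro m k l hkm hlm hkl
  cases n with
  | zero => exact m.elim0
  | succ n =>
    obtain ⟨m, rfl⟩ := Fin.exists_succAbove_eq hlm.symm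
    obtain ⟨k, rfl⟩ := Fin.exists_succAbove_eq hkl
    refine measure_eq_zero_iff_ae_notMem.1 (measure_pi_eq_zero_of_section μ l
      (measurableSet_eq_fun (measurable_dist_coord _ _) (measurable_dist_coord _ _)) fun w => ?_)
    refine measure_mono_null (fun z hz => ?_) (hμ (w m) (dist (w m) (w k)))
    have : dist (w m) (w k) = dist (w m) z := by
      have h1 : dist _ _ = dist _ _ := hz
      simpa using h1
    rw [Metric.mem_sphere, dist_comm, this]

/-- Given the position of `j`, the `j` earlier points must independently avoid the ball around it.
-/
theorem measure_lt_parentDist_le {q : ENNReal} {t : ℝ} (hq : ∀ y, q ≤ μ (Metric.closedBall y t))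
    {n : ℕ} (j : Fin n) :
    (Measure.pi fun _ : Fin n => μ) {x | ENNReal.ofReal t < parentDist x j} ≤
      (1 - q) ^ j.val := by
  cases n with
  | zero => exact j.elim0
  | succ n =>
    have hs : MeasurableSet {x : Fin (n + 1) → X | ENNReal.ofReal t < parentDist x j} :=
      measurableSet_lt measurable_const (measurable_parentDist j)
    rw [← (measurePreserving_insertNth μ j).measure_preimage hs.nullMeasurableSet,
      Measure.prod_apply (measurable_insertNth j hs)]
    refine (lintegral_mono (g := fun _ => (1 - q) ^ j.val) fun y => ?_).trans (by simp)
    have hsub : Prod.mk y ⁻¹' ((fun q : X × (Fin n → X) =>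
        (j.insertNth q.1 q.2 : Fin (n + 1) → X)) ⁻¹'
          {x : Fin (n + 1) → X | ENNReal.ofReal t < parentDist x j}) ⊆
        Set.univ.pi fun k : Fin n => if k.castSucc < j then (Metric.closedBall y t)ᶜ else
          Set.univ := by
      intro w hw k _
      beta_reduce
      split_ifs with hk
      · have h1 : ENNReal.ofReal t < edist y (w k) := by
          have h2 := lt_of_lt_of_le (show ENNReal.ofReal t <
            parentDist (j.insertNth y w : Fin (n + 1) → X) j from hw)
            (iInf₂_le (j.succAbove k) (by rwa [Fin.succAbove_of_castSucc_lt _ _ hk]))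
          simpa using h2
        intro h3
        rw [edist_dist] at h1
        exact absurd (ENNReal.ofReal_le_ofReal (Metric.mem_closedBall'.1 h3)) (not_le.2 h1)
      · trivial
    refine (measure_mono hsub).trans ?_
    rw [Measure.pi_pi]
    have hfac : ∀ k : Fin n, μ (if k.castSucc < j then (Metric.closedBall y t)ᶜ else Set.univ) ≤
        if k.castSucc < j then 1 - q else 1 := by
      intro k
      split_ifs
      · rw [prob_compl_eq_one_sub measurableSet_closedBall]
        exact tsub_le_tsub_left (hq y) 1
      · exact prob_le_one
    refine (Finset.prod_le_prod' fun k _ => hfac k).trans ?_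
    rw [Finset.prod_ite, Finset.prod_const, Finset.prod_const_one, mul_one]
    have hcard : (Finset.univ.filter fun k : Fin n => k.castSucc < j).card = j.val := by
      simp only [Fin.lt_def, Fin.val_castSucc]
      rw [Fin.card_filter_val_lt]
      exact min_eq_right (Nat.lt_succ_iff.1 j.isLt)
    rw [hcard]

/-- The mean ancestral length, for any choice of thresholds `t j` and an upper bound `D` for the
distances. -/
theorem lintegral_ancestralLength_le (hμ : ∀ y r, μ (Metric.sphere y r) = 0)
    {D : ENNReal} (hD : ∀ y z : X, edist y z ≤ D) {q : ℕ → ENNReal} {t : ℕ → ℝ}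
    (hq : ∀ j, 0 < j → ∀ y, q j ≤ μ (Metric.closedBall y (t j))) {n : ℕ} (i : Fin n) :
    ∫⁻ x, ancestralLength x i ∂(Measure.pi fun _ : Fin n => μ) ≤
      D + ∑' j : ℕ, (ENNReal.ofReal (t (j + 1)) * ((j : ENNReal) + 1 + 1)⁻¹ +
        D * (1 - q (j + 1)) ^ (j + 1)) := by
  classical
  set ν := Measure.pi fun _ : Fin n => μ
  -- Label 0 must be excluded: its infimum is over an empty set and equals `⊤`.
  have hpD : ∀ (x : Fin n → X) (j : Fin n), 0 < j.val → parentDist x j ≤ D := fun x j hj =>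
    (iInf₂_le (⟨0, hj.trans j.isLt⟩ : Fin n) hj).trans (hD _ _)
  set f : ℕ → ENNReal := fun j => ENNReal.ofReal (t j) * ((j : ENNReal) + 1)⁻¹ +
    D * (1 - q j) ^ j
  have hterm : ∀ j : Fin n, 0 < j.val →
      ∫⁻ x, (if IsAncestor x i j then parentDist x j else 0) ∂ν ≤
        (if j = i then D else 0) + f j := by
    intro j hj
    rcases eq_or_ne j i with rfl | hji
    · rw [if_pos rfl]
      refine le_add_right ((lintegral_mono (g := fun _ => D) fun x => ?_).trans (by simp))
      split_ifs
      · exact hpD x j hj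
      · exact zero_le
    rw [if_neg hji, zero_add]
    by_cases hlt : j < i
    · have hA := measurableSet_isAncestor (X := X) i j
      have hB : MeasurableSet {x : Fin n → X | ENNReal.ofReal (t j) < parentDist x j} :=
        measurableSet_lt measurable_const (measurable_parentDist j)
      -- Truncation at `t j` separates the two events, so no independence between ancestry and the
      -- nearest distance is needed.
      calc ∫⁻ x, (if IsAncestor x i j then parentDist x j else 0) ∂ν
          ≤ ∫⁻ x, (Set.indicator {x | IsAncestor x i j} (fun _ => ENNReal.ofReal (t j)) x +
              Set.indicator {x | ENNReal.ofReal (t j) < parentDist x j} (fun _ => D) x) ∂ν := by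
            refine lintegral_mono fun x => ?_
            by_cases h1 : IsAncestor x i j
            · by_cases h2 : ENNReal.ofReal (t j) < parentDist x j
              · simpa [h1, h2] using le_add_left (hpD x j hj)
              · simpa [h1, h2] using not_lt.1 h2
            · simp [h1]
        _ = ENNReal.ofReal (t j) * ν {x | IsAncestor x i j} +
              D * ν {x | ENNReal.ofReal (t j) < parentDist x j} := by
            rw [lintegral_add_left (measurable_const.indicator hA),
              lintegral_indicator_const hA, lintegral_indicator_const hB]
        _ ≤ f j := by
            refine add_le_add ?_ ?_
            · gcongr
              exact measure_isAncestor_le μ (ae_hasNoTies μ hμ n) hlt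
            · gcongr
              exact measure_lt_parentDist_le μ (hq j hj) j
    · refine le_of_eq_of_le ?_ zero_le
      simp [fun x : Fin n → X => mt (IsAncestor.le (x := x) (i := i) (j := j))
        (not_le.2 (lt_of_le_of_ne (not_lt.1 hlt) hji.symm))]
  have hmeas : ∀ j : Fin n, Measurable fun x : Fin n → X =>
      if IsAncestor x i j then parentDist x j else 0 := fun j =>
    Measurable.ite (measurableSet_isAncestor i j) (measurable_parentDist j) measurable_const
  have hint : ∫⁻ x, ancestralLength x i ∂ν =
      ∑ j : Fin n with 0 < j.val, ∫⁻ x, (if IsAncestor x i j then parentDist x j else 0) ∂ν := by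
    rw [← lintegral_finsetSum _ fun j _ => hmeas j]
    refine lintegral_congr fun x => Finset.sum_congr rfl fun j _ => ?_
    congr
  rw [hint]
  refine (Finset.sum_le_sum fun j hj => hterm j (Finset.mem_filter.1 hj).2).trans ?_
  rw [Finset.sum_add_distrib]
  refine add_le_add ?_ ?_
  · rw [Finset.sum_ite_eq']
    split_ifs
    · exact le_rfl
    · exact zero_le
  -- The positive labels are shifted down by one to index the series from 0.
  · have hinj : Set.InjOn (fun j : Fin n => j.val - 1)
        (Finset.univ.filter fun j : Fin n => 0 < j.val : Finset (Fin n)) := by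
      intro a ha b hb hab
      have ha' : 0 < a.val := by simpa using ha
      have hb' : 0 < b.val := by simpa using hb
      simp only at hab
      exact Fin.ext (by omega)
    calc ∑ j : Fin n with 0 < j.val, f j
        = ∑ j : Fin n with 0 < j.val, f (j.val - 1 + 1) :=
          Finset.sum_congr rfl fun j hj => by
            rw [Nat.sub_add_cancel (Finset.mem_filter.1 hj).2]
      _ = ∑ k ∈ (Finset.univ.filter fun j : Fin n => 0 < j.val).image fun j => j.val - 1,
            f (k + 1) := (Finset.sum_image (f := fun k => f (k + 1)) hinj).symm
      _ ≤ ∑' k, f (k + 1) := ENNReal.sum_le_tsum _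
      _ = _ := by simp [f]

end Product

/-! ### Balls and spheres in a circle. -/

section Circle

variable {T : ℝ} [hT : Fact (0 < T)]

theorem haarAddCircle_closedBall (c : AddCircle T) (r : ℝ) :
    (AddCircle.haarAddCircle : Measure (AddCircle T)) (Metric.closedBall c r) =
      ENNReal.ofReal (min 1 (2 * r / T)) := by
  have h1 := AddCircle.volume_closedBall T (x := c) r
  rw [AddCircle.volume_eq_smul_haarAddCircle, Measure.smul_apply, smul_eq_mul] at h1
  have h0 : ENNReal.ofReal T ≠ 0 := (ENNReal.ofReal_pos.2 hT.out).ne'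
  rw [← ENNReal.mul_right_inj h0 ENNReal.ofReal_ne_top, h1, ← ENNReal.ofReal_mul hT.out.le,
    mul_min_of_nonneg _ _ hT.out.le, mul_one, mul_div_cancel₀ _ hT.out.ne']

theorem haarAddCircle_sphere (c : AddCircle T) (r : ℝ) :
    (AddCircle.haarAddCircle : Measure (AddCircle T)) (Metric.sphere c r) = 0 := by
  have hsing : ∀ a : AddCircle T,
      (AddCircle.haarAddCircle : Measure (AddCircle T)) {a} = 0 := fun a => by
    rw [← Metric.closedBall_zero, haarAddCircle_closedBall]
    simp
  have hsub : Metric.sphere c r ⊆ {c + (r : AddCircle T)} ∪ {c + ((-r : ℝ) : AddCircle T)} := by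
    intro z hz
    have hz' : ‖z - c‖ = r := by rwa [mem_sphere_iff_norm] at hz
    obtain ⟨s, hs⟩ := QuotientAddGroup.mk_surjective (z - c)
    -- The representative nearest to 0 has absolute value `r`, so it is `r` or `-r`.
    have hs' : ((s - round (T⁻¹ * s) * T : ℝ) : AddCircle T) = z - c := by
      rw [← hs, AddCircle.coe_sub, sub_eq_self, ← zsmul_eq_mul]
      exact (AddCircle.coe_eq_zero_iff T).2 ⟨_, rfl⟩
    have hr : |s - round (T⁻¹ * s) * T| = r := by
      rw [← hz', ← hs]
      exact (AddCircle.norm_eq T).symm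
    rcases abs_eq_abs.1 (hr.trans (abs_of_nonneg (hr ▸ abs_nonneg _)).symm) with h | h
    · left
      rw [Set.mem_singleton_iff, ← h, hs']
      abel
    · right
      rw [Set.mem_singleton_iff, ← h, hs']
      abel
  exact measure_mono_null hsub (measure_union_null (hsing _) (hsing _))

theorem AddCircle.dist_le_half (a b : AddCircle T) : dist a b ≤ T / 2 := by
  rw [dist_eq_norm]
  simpa [abs_of_pos hT.out] using AddCircle.norm_le_half_period T hT.out.ne' (x := a - b)

end Circle

/-! ### Balls and spheres in the flat torus. -/

section Torus

variable {d n : ℕ}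

theorem FlatTorus.dist_eq (y z : FlatTorus d n) : dist y z = √(∑ i, dist (y i) (z i) ^ 2) :=
  PiLp.dist_eq_of_L2 y z

theorem FlatTorus.dist_le_of_forall {y z : FlatTorus d n} {r : ℝ} (hr : 0 ≤ r)
    (h : ∀ i, dist (y i) (z i) ≤ r) : dist y z ≤ r * √d := by
  rw [FlatTorus.dist_eq]
  calc √(∑ i, dist (y i) (z i) ^ 2) ≤ √(∑ _i : Fin d, r ^ 2) :=
        Real.sqrt_le_sqrt (Finset.sum_le_sum fun i _ => pow_le_pow_left₀ dist_nonneg (h i) 2)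
    _ = r * √d := by
        rw [Finset.sum_const, Finset.card_fin, nsmul_eq_mul, mul_comm,
          Real.sqrt_mul (sq_nonneg r), Real.sqrt_sq hr]

theorem FlatTorus.dist_apply_le (y z : FlatTorus d n) (i : Fin d) : dist (y i) (z i) ≤ dist y z := by
  rw [FlatTorus.dist_eq]
  refine Real.le_sqrt_of_sq_le ?_
  exact Finset.single_le_sum (f := fun i => dist (y i) (z i) ^ 2) (fun i _ => sq_nonneg _)
    (Finset.mem_univ i)

variable [NeZero n]

theorem torusSide_pos (d n : ℕ) [NeZero n] : 0 < torusSide d n := (torusSide_fact d n).out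

instance : IsProbabilityMeasure (torusUniform d n) :=
  Measure.isProbabilityMeasure_map (WithLp.measurable_toLp 2 _).aemeasurable

theorem torusUniform_apply {s : Set (FlatTorus d n)} (hs : MeasurableSet s) :
    torusUniform d n s =
      (Measure.pi fun _ : Fin d => (AddCircle.haarAddCircle : Measure (AddCircle (torusSide d n))))
        {z | WithLp.toLp 2 z ∈ s} :=
  Measure.map_apply (WithLp.measurable_toLp 2 _) hs

/-- Once the other coordinates are fixed, coordinate 0 lies on a sphere of the circle, which is
null. -/
theorem torusUniform_sphere (hd : 1 ≤ d) (y : FlatTorus d n) (r : ℝ) :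
    torusUniform d n (Metric.sphere y r) = 0 := by
  obtain ⟨e, rfl⟩ : ∃ e, d = e + 1 := ⟨d - 1, by omega⟩
  have hs : MeasurableSet (Metric.sphere y r) := Metric.isClosed_sphere.measurableSet
  rw [torusUniform_apply hs]
  refine measure_pi_eq_zero_of_section _ 0 (WithLp.measurable_toLp 2 _ hs) fun w => ?_
  refine measure_mono_null (fun c hc => ?_) (haarAddCircle_sphere (y 0)
    (√(r ^ 2 - ∑ i, dist (w i) (y i.succ) ^ 2)))
  have h1 : dist (WithLp.toLp 2 (Fin.insertNth 0 c w) : FlatTorus (e + 1) n) y = r := hc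
  rw [FlatTorus.dist_eq, Fin.sum_univ_succ] at h1
  simp only [Fin.insertNth_zero', Fin.cons_zero, Fin.cons_succ] at h1
  rw [Metric.mem_sphere, ← h1, Real.sq_sqrt (by positivity), add_sub_cancel_right,
    Real.sqrt_sq dist_nonneg]

theorem FlatTorus.dist_le (y z : FlatTorus d n) : dist y z ≤ torusSide d n / 2 * √d :=
  FlatTorus.dist_le_of_forall (by have := torusSide_pos d n; positivity)
    fun _ => AddCircle.dist_le_half _ _

/-- The ball contains a product of `d` arcs, each of measure `s`. -/
theorem le_torusUniform_closedBall {s : ℝ} (hs0 : 0 ≤ s) (hs1 : s ≤ 1) (y : FlatTorus d n) :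
    ENNReal.ofReal (s ^ d) ≤
      torusUniform d n (Metric.closedBall y (s * (torusSide d n / 2 * √d))) := by
  have hT := torusSide_pos d n
  rw [torusUniform_apply measurableSet_closedBall]
  calc ENNReal.ofReal (s ^ d)
      = (Measure.pi fun _ : Fin d =>
          (AddCircle.haarAddCircle : Measure (AddCircle (torusSide d n))))
          (Set.univ.pi fun i => Metric.closedBall (y i) (s * (torusSide d n / 2))) := by
        rw [Measure.pi_pi]
        simp only [haarAddCircle_closedBall]
        rw [Finset.prod_const, Finset.card_fin, ENNReal.ofReal_pow hs0]
        congr 2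
        rw [show 2 * (s * (torusSide d n / 2)) / torusSide d n = s by field_simp, min_eq_right hs1]
    _ ≤ _ := by
        refine measure_mono fun z hz => ?_
        have hz' : ∀ i, dist (z i) (y i) ≤ s * (torusSide d n / 2) := fun i => hz i trivial
        have := FlatTorus.dist_le_of_forall (y := WithLp.toLp 2 z) (z := y) (by positivity) hz'
        rw [mul_assoc] at this
        exact this

/-- The ball projects into an arc in one coordinate; this crude bound is enough to make close pairs
rare. -/
theorem torusUniform_closedBall_le (hd : 1 ≤ d) (δ : ℝ) (y : FlatTorus d n) :
    torusUniform d n (Metric.closedBall y (δ * torusSide d n)) ≤ ENNReal.ofReal (2 * δ) := by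
  have hT := torusSide_pos d n
  rw [torusUniform_apply measurableSet_closedBall]
  have hsub : {z : Fin d → AddCircle (torusSide d n) |
      WithLp.toLp 2 z ∈ Metric.closedBall y (δ * torusSide d n)} ⊆
      Function.eval (⟨0, hd⟩ : Fin d) ⁻¹'
        Metric.closedBall (y ⟨0, hd⟩) (δ * torusSide d n) := fun z hz =>
    (FlatTorus.dist_apply_le (WithLp.toLp 2 z) y ⟨0, hd⟩).trans hz
  refine (measure_mono hsub).trans ?_
  rw [(measurePreserving_eval _ _).measure_preimage measurableSet_closedBall.nullMeasurableSet,
    haarAddCircle_closedBall]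
  refine ENNReal.ofReal_le_ofReal ((min_le_right _ _).trans_eq ?_)
  field_simp

theorem measure_dist_le (hd : 1 ≤ d) (δ : ℝ) {m : ℕ} {a b : Fin m} (hab : a ≠ b) :
    (Measure.pi fun _ : Fin m => torusUniform d n)
      {x | dist (x a) (x b) ≤ δ * torusSide d n} ≤ ENNReal.ofReal (2 * δ) := by
  cases m with
  | zero => exact a.elim0
  | succ m =>
    obtain ⟨b, rfl⟩ := Fin.exists_succAbove_eq hab.symm
    have hs : MeasurableSet {x : Fin (m + 1) → FlatTorus d n |
        dist (x a) (x (a.succAbove b)) ≤ δ * torusSide d n} :=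
      measurableSet_le (measurable_dist_coord _ _) measurable_const
    rw [← (measurePreserving_insertNth _ a).measure_preimage hs.nullMeasurableSet,
      Measure.prod_apply_symm (measurable_insertNth a hs)]
    refine (lintegral_mono (g := fun _ => ENNReal.ofReal (2 * δ)) fun w => ?_).trans (by simp)
    refine (measure_mono fun z hz => ?_).trans (torusUniform_closedBall_le hd δ (w b))
    have h1 : dist _ _ ≤ δ * torusSide d n := hz
    simpa using h1

end Torus

/-! ### Choice of thresholds and summation. -/

section MeanBound

theorem one_sub_rpow_pow_le {j : ℕ} (hj : 0 < j) :
    (1 - (j : ℝ) ^ (-(1 / 2) : ℝ)) ^ j ≤ 24 / (j : ℝ) ^ 2 := by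
  have hj0 : (0 : ℝ) < j := Nat.cast_pos.2 hj
  have hj1 : (1 : ℝ) ≤ j := Nat.one_le_cast.2 hj
  have h1 : (j : ℝ) ^ (-(1 / 2) : ℝ) ≤ 1 := Real.rpow_le_one_of_one_le_of_nonpos hj1 (by norm_num)
  have h2 : (j : ℝ) * (j : ℝ) ^ (-(1 / 2) : ℝ) = √j := by
    rw [Real.sqrt_eq_rpow, ← Real.rpow_one_add' hj0.le (by norm_num)]
    norm_num
  calc (1 - (j : ℝ) ^ (-(1 / 2) : ℝ)) ^ j
      ≤ Real.exp (-(j : ℝ) ^ (-(1 / 2) : ℝ)) ^ j :=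
        pow_le_pow_left₀ (sub_nonneg.2 h1) (Real.one_sub_le_exp_neg _) j
    _ = (Real.exp √j)⁻¹ := by
        rw [← Real.exp_nat_mul, mul_neg, h2, Real.exp_neg]
    -- The fourth Taylor term of the exponential yields `j ^ 2`, enough for summability.
    _ ≤ ((√j) ^ 4 / (Nat.factorial 4 : ℝ))⁻¹ :=
        inv_anti₀ (by positivity) (Real.pow_div_factorial_le_exp _ (Real.sqrt_nonneg _) 4)
    _ = 24 / (j : ℝ) ^ 2 := by
        rw [inv_div, show (√(j : ℝ)) ^ 4 = (j : ℝ) ^ 2 by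
          rw [show 4 = 2 * 2 from rfl, pow_mul, Real.sq_sqrt hj0.le]]
        norm_num [Nat.factorial]

theorem summable_thresholds {d : ℕ} (hd : 1 ≤ d) :
    Summable fun j : ℕ => ((j + 1 : ℕ) : ℝ) ^ (-(1 / (2 * d)) : ℝ) / ((j : ℝ) + 2) +
      24 / ((j + 1 : ℕ) : ℝ) ^ 2 := by
  have hd0 : (0 : ℝ) < d := Nat.cast_pos.2 hd
  refine Summable.add ?_ ?_
  · have h1 : Summable fun j : ℕ => ((j + 1 : ℕ) : ℝ) ^ (-(1 / (2 * d)) - 1 : ℝ) :=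
      (summable_nat_add_iff 1).2 (Real.summable_nat_rpow.2 (by
        have : (0 : ℝ) < 1 / (2 * d) := by positivity
        linarith))
    refine h1.of_nonneg_of_le (fun j => by positivity) fun j => ?_
    have hj : (0 : ℝ) < ((j + 1 : ℕ) : ℝ) := by positivity
    rw [Real.rpow_sub_one hj.ne']
    gcongr
    push_cast
    linarith
  · have h1 : Summable fun j : ℕ => 1 / ((j + 1 : ℕ) : ℝ) ^ 2 :=
      (summable_nat_add_iff (f := fun j : ℕ => 1 / (j : ℝ) ^ 2) 1).2
        (Real.summable_one_div_nat_pow.2 one_lt_two)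
    simpa [div_eq_mul_inv] using h1.mul_left 24

/-- The mean ancestral length is at most a constant times the side length of the torus. -/
theorem exists_lintegral_ancestralLength_le {d : ℕ} (hd : 1 ≤ d) :
    ∃ C : ℝ, 0 < C ∧ ∀ (n : ℕ) [NeZero n] (m : ℕ) (i : Fin m),
      ∫⁻ x, ancestralLength x i ∂(Measure.pi fun _ : Fin m => torusUniform d n) ≤
        ENNReal.ofReal (C * torusSide d n) := by
  have hd0 : (0 : ℝ) < d := Nat.cast_pos.2 hd
  set g : ℕ → ℝ := fun j => ((j + 1 : ℕ) : ℝ) ^ (-(1 / (2 * d)) : ℝ) / ((j : ℝ) + 2) +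
      24 / ((j + 1 : ℕ) : ℝ) ^ 2
  have hg0 : ∀ j, 0 ≤ g j := fun j => by positivity
  have hg : Summable g := summable_thresholds hd
  have hS : 0 ≤ ∑' j, g j := tsum_nonneg hg0
  refine ⟨1 / 2 * √d * (1 + ∑' j, g j), by positivity, fun n _ m i => ?_⟩
  have hT := torusSide_pos d n
  set D : ℝ := torusSide d n / 2 * √d with hDdef
  have hD : 0 ≤ D := by positivity
  -- The exponent makes `s j ^ d = j ^ (-1 / 2)`: small balls still expect about `√j` earlier
  -- points, while `s j / (j + 1)` stays summable.
  set s : ℕ → ℝ := fun j => (j : ℝ) ^ (-(1 / (2 * d)) : ℝ)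
  have hs0 : ∀ j, 0 ≤ s j := fun j => by positivity
  have hs1 : ∀ j, 0 < j → s j ≤ 1 := fun j hj =>
    Real.rpow_le_one_of_one_le_of_nonpos (Nat.one_le_cast.2 hj) (neg_nonpos.2 (by positivity))
  have hsd : ∀ j, s j ^ d = (j : ℝ) ^ (-(1 / 2) : ℝ) := fun j => by
    rw [← Real.rpow_natCast, ← Real.rpow_mul (Nat.cast_nonneg j)]
    congr 1
    field_simp
  refine (lintegral_ancestralLength_le (torusUniform d n) (torusUniform_sphere hd)
    (D := ENNReal.ofReal D) (q := fun j => ENNReal.ofReal (s j ^ d)) (t := fun j => s j * D)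
    (fun y z => by
      rw [edist_dist]
      exact ENNReal.ofReal_le_ofReal (FlatTorus.dist_le y z))
    (fun j hj y => le_torusUniform_closedBall (hs0 j) (hs1 j hj) y) i).trans ?_
  have hterm : ∀ j : ℕ, ENNReal.ofReal (s (j + 1) * D) * ((j : ENNReal) + 1 + 1)⁻¹ +
      ENNReal.ofReal D * (1 - ENNReal.ofReal (s (j + 1) ^ d)) ^ (j + 1) ≤
      ENNReal.ofReal D * ENNReal.ofReal (g j) := by
    intro j
    have h1 : ((j : ENNReal) + 1 + 1)⁻¹ = ENNReal.ofReal (((j : ℝ) + 2)⁻¹) := by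
      rw [ENNReal.ofReal_inv_of_pos (by positivity), ENNReal.ofReal_add (by positivity) (by norm_num),
        ENNReal.ofReal_natCast, add_assoc, one_add_one_eq_two]
      simp
    have h2 : (0 : ℝ) ≤ 1 - s (j + 1) ^ d :=
      sub_nonneg.2 (pow_le_one₀ (hs0 _) (hs1 _ j.succ_pos))
    rw [h1, ← ENNReal.ofReal_one, ← ENNReal.ofReal_sub _ (pow_nonneg (hs0 _) _),
      ← ENNReal.ofReal_pow h2, ← ENNReal.ofReal_mul (mul_nonneg (hs0 _) hD),
      ← ENNReal.ofReal_mul hD, ← ENNReal.ofReal_mul hD, ← ENNReal.ofReal_add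
        (mul_nonneg (mul_nonneg (hs0 _) hD) (by positivity)) (mul_nonneg hD (pow_nonneg h2 _))]
    refine ENNReal.ofReal_le_ofReal ?_
    have h3 := one_sub_rpow_pow_le j.succ_pos
    rw [hsd]
    calc s (j + 1) * D * ((j : ℝ) + 2)⁻¹ +
          D * (1 - ((j + 1 : ℕ) : ℝ) ^ (-(1 / 2) : ℝ)) ^ (j + 1)
        ≤ s (j + 1) * D * ((j : ℝ) + 2)⁻¹ + D * (24 / ((j + 1 : ℕ) : ℝ) ^ 2) := by
          gcongr
      _ = D * g j := by
          simp only [s, g]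
          ring
  refine (add_le_add le_rfl (ENNReal.tsum_le_tsum hterm)).trans ?_
  rw [ENNReal.tsum_mul_left, ← ENNReal.ofReal_tsum_of_nonneg hg0 hg, ← ENNReal.ofReal_mul hD,
    ← ENNReal.ofReal_add hD (mul_nonneg hD hS)]
  refine ENNReal.ofReal_le_ofReal (le_of_eq ?_)
  rw [hDdef]
  ring

end MeanBound

/-! ### The random pair and the final union bound. -/

/-- Conditioning on the independent index `w`. Only values of positive mass matter, which lets the
pairs on the diagonal be ignored. -/
theorem measure_le_of_forall_pair {Ω X ι : Type*} [MeasurableSpace Ω] [MeasurableSpace X]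
    [Finite ι] [MeasurableSpace ι] [MeasurableSingletonClass ι]
    {P : Measure Ω} [IsProbabilityMeasure P] {w : Ω → ι} {x : Ω → X} (hw : AEMeasurable w P)
    (hx : AEMeasurable x P) (h : IndepFun w x P) {B : ι → Set X} (hB : ∀ a, MeasurableSet (B a))
    {β : ENNReal} (hβ : ∀ a, P.map w {a} ≠ 0 → P.map x (B a) ≤ β) :
    P {ω | x ω ∈ B (w ω)} ≤ β := by
  have := Fintype.ofFinite ι
  have := Measure.isProbabilityMeasure_map hw
  calc P {ω | x ω ∈ B (w ω)} ≤ P (⋃ a, w ⁻¹' {a} ∩ x ⁻¹' B a) :=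
        measure_mono fun ω hω => Set.mem_iUnion.2 ⟨w ω, rfl, hω⟩
    _ ≤ ∑ a, P (w ⁻¹' {a} ∩ x ⁻¹' B a) := measure_iUnion_fintype_le _ _
    _ ≤ ∑ a, P.map w {a} * β := by
        refine Finset.sum_le_sum fun a _ => ?_
        rw [h.measure_inter_preimage_eq_mul _ _ (measurableSet_singleton a) (hB a),
          ← Measure.map_apply_of_aemeasurable hw (measurableSet_singleton a),
          ← Measure.map_apply_of_aemeasurable hx (hB a)]
        by_cases h0 : P.map w {a} = 0
        · simp [h0]
        · gcongr
          exact hβ a h0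
    _ = β := by
        rw [← Finset.sum_mul, sum_measure_singleton]
        simp

theorem mainTheorem9 (d : ℕ) (hd : 1 ≤ d) (ε : ℝ) (hε : 0 < ε)
    (hεd : ε < (d : ℝ) ^ (-(d : ℝ) / 2)) :
    ∃ c : ℝ, 0 < c ∧
      ∀ (n : ℕ) [NeZero n], 2 ≤ n →
      ∀ {Ω : Type*} [MeasurableSpace Ω] (P : Measure Ω) [IsProbabilityMeasure P]
        -- the positions of the vertices, independent and uniform on the torus
        (p : Fin n → Ω → FlatTorus d n),
        (∀ i, HasLaw (p i) (torusUniform d n) P) →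
        iIndepFun p P →
      ∀ -- the tree
        (G : Ω → SimpleGraph (Fin n))
        (hG : ∀ ω, IsNNTree (fun i => p i ω) (G ω))
        -- a uniform pair of distinct vertices, independent of the positions
        (u v : Ω → Fin n),
        HasLaw (fun ω => (u ω, v ω)) (uniformOn {x : Fin n × Fin n | x.1 ≠ x.2}) P →
        IndepFun (fun ω => (u ω, v ω)) (fun ω i => p i ω) P →
        1 - ε ≤ P.real {ω | p (u ω) ω ≠ p (v ω) ω ∧ (hG ω).stretchFactor (u ω) (v ω) ≤ c} := by
  obtain ⟨C, hC, hmean⟩ := exists_lintegral_ancestralLength_le hd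
  -- In units of the side length: two ancestral lengths of at most `4 * C / ε`, divided by a
  -- distance of at least `ε / 4`.
  refine ⟨2 * (4 * C / ε) / (ε / 4), by positivity, ?_⟩
  intro n _ _ Ω _ P _ p hp hpi G hG u v huv hind
  have hT := torusSide_pos d n
  have hx : HasLaw (fun ω i => p i ω) (Measure.pi fun _ : Fin n => torusUniform d n) P :=
    hpi.hasLaw_pi hp
  set ν := Measure.pi fun _ : Fin n => torusUniform d n
  set K : ℝ := 4 * C / ε with hK
  have hK0 : 0 < K := by positivity
  set τ : ENNReal := ENNReal.ofReal (K * torusSide d n)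
  have hτ0 : τ ≠ 0 := (ENNReal.ofReal_pos.2 (by positivity)).ne'
  let A : Fin n → Set (Fin n → FlatTorus d n) := fun i => {x | τ ≤ ancestralLength x i}
  have hAm : ∀ i, MeasurableSet (A i) := fun i =>
    measurableSet_le measurable_const (measurable_ancestralLength i)
  have hA : ∀ i, ν (A i) ≤ ENNReal.ofReal (ε / 4) := by
    intro i
    refine (meas_ge_le_lintegral_div (measurable_ancestralLength i).aemeasurable hτ0
      ENNReal.ofReal_ne_top).trans ?_
    refine (ENNReal.div_le_div_right (hmean n n i) τ).trans_eq ?_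
    rw [← ENNReal.ofReal_div_of_pos (by positivity)]
    congr 1
    rw [hK]
    field_simp
  -- Bad configurations for a pair: probability at most `ε / 2` for closeness and, by Markov, `ε /
  -- 4` for each long descent.
  let B : Fin n × Fin n → Set (Fin n → FlatTorus d n) := fun a =>
    {x | dist (x a.1) (x a.2) ≤ ε / 4 * torusSide d n} ∪ (A a.1 ∪ A a.2)
  have hBm : ∀ a, MeasurableSet (B a) := fun a =>
    (measurableSet_le (measurable_dist_coord _ _) measurable_const).union
      ((hAm _).union (hAm _))
  have hB : ∀ a : Fin n × Fin n, a.1 ≠ a.2 → ν (B a) ≤ ENNReal.ofReal ε := by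
    intro a ha
    calc ν (B a) ≤ ENNReal.ofReal (2 * (ε / 4)) +
          (ENNReal.ofReal (ε / 4) + ENNReal.ofReal (ε / 4)) :=
          (measure_union_le _ _).trans (add_le_add (measure_dist_le hd _ ha)
            ((measure_union_le _ _).trans (add_le_add (hA _) (hA _))))
      _ = ENNReal.ofReal ε := by
          rw [← ENNReal.ofReal_add (by positivity) (by positivity),
            ← ENNReal.ofReal_add (by positivity) (by positivity)]
          congr 1
          ring
  have hbad : P {ω | (fun i => p i ω) ∈ B (u ω, v ω)} ≤ ENNReal.ofReal ε := by
    refine measure_le_of_forall_pair huv.aemeasurable hx.aemeasurable hind hBm fun a ha => ?_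
    rw [hx.map_eq]
    refine hB a fun h => ha ?_
    rw [huv.map_eq, uniformOn, cond_apply (Set.toFinite _).measurableSet]
    have : {x : Fin n × Fin n | x.1 ≠ x.2} ∩ {a} = ∅ := by
      ext x
      simp only [Set.mem_inter_iff, Set.mem_singleton_iff, Set.mem_empty_iff_false, iff_false]
      rintro ⟨hx1, rfl⟩
      exact hx1 h
    rw [this]
    simp
  have hgood : ∀ ω, (fun i => p i ω) ∉ B (u ω, v ω) →
      p (u ω) ω ≠ p (v ω) ω ∧ (hG ω).stretchFactor (u ω) (v ω) ≤ 2 * K / (ε / 4) := by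
    intro ω hω
    have h1 : ε / 4 * torusSide d n < dist (p (u ω) ω) (p (v ω) ω) :=
      not_le.1 fun h => hω (Or.inl h)
    have h2 : ancestralLength (fun i => p i ω) (u ω) < τ :=
      not_le.1 fun h => hω (Or.inr (Or.inl h))
    have h3 : ancestralLength (fun i => p i ω) (v ω) < τ :=
      not_le.1 fun h => hω (Or.inr (Or.inr h))
    have h0 : 0 < ε / 4 * torusSide d n := by positivity
    refine ⟨dist_pos.1 (h0.trans h1), ?_⟩
    have h4 := ((hG ω).euclideanLength_treePath_le (u ω) (v ω)).trans (add_le_add h2.le h3.le)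
    rw [← ENNReal.ofReal_add (by positivity) (by positivity),
      ENNReal.ofReal_le_ofReal_iff (by positivity)] at h4
    unfold IsNNTree.stretchFactor
    calc euclideanLength (fun i => p i ω) ((hG ω).treePath (u ω) (v ω)) /
          dist (p (u ω) ω) (p (v ω) ω)
        ≤ (K * torusSide d n + K * torusSide d n) / (ε / 4 * torusSide d n) :=
          div_le_div₀ (by positivity) h4 h0 h1.le
      _ = 2 * K / (ε / 4) := by
          field_simp
          ring
  have hcover : (1 : ENNReal) ≤ ENNReal.ofReal ε +
      P {ω | p (u ω) ω ≠ p (v ω) ω ∧ (hG ω).stretchFactor (u ω) (v ω) ≤ 2 * K / (ε / 4)} := by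
    rw [← measure_univ (μ := P)]
    refine (measure_mono fun ω _ => ?_).trans ((measure_union_le _ _).trans
      (add_le_add hbad le_rfl))
    by_cases hω : (fun i => p i ω) ∈ B (u ω, v ω)
    · exact Or.inl hω
    · exact Or.inr (hgood ω hω)
  rw [Measure.real, sub_le_iff_le_add']
  have h5 := ENNReal.toReal_mono (by finiteness) hcover
  rwa [ENNReal.toReal_add (by finiteness) (by finiteness), ENNReal.toReal_one,
    ENNReal.toReal_ofReal hε.le] at h5
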